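/- Let $T$ be a diagram of an oriented virtual tangle with ordered components $T_1,\dots,T_n$, each either long (an arc) or closed, with a starting point on each closed component; a long component starts at its initial end. A crossing is a self-crossing if both strands belong to the same component and mixed otherwise. Fix integers $c_1,\dots,c_n$. *Labeling and polynomial.* Label $T_i$ by starting with $c_i$ at its starting point and propagating along the orientation. With both strands of a crossing drawn upwards, the label changes by $-1$ along the strand from bottom left to top right of a classical crossing, by $+1$ along the strand from bottom right to top left, and does not change at virtual crossings. At a positive crossing the overstrand is the one running from bottom left to top right, at a negative crossing it is the other one. Let $\delta_i$ be the final minus the initial label of $T_i$. The weight of a classical crossing $d$ is $W(d)=a-b-\mathrm{sgn}(d)$, where $a$, $b$ are the incoming labels of the over- and understrand. The multi-variable affine index polynomial (MAIP) is the Laurent polynomial $$p_T(t_1,\dots,t_n)=\sum_{i,j}\ \sum_{d:\ T_i\text{ over }T_j}\mathrm{sgn}(d)\,t_i^{\delta_j}\bigl(t_i^{W(d)}-1\bigr)$$ (sums over classical crossings $d$, with $i=j$ allowed). *Homological weights.* For two parts $A,B$ of a diagram meeting transversally, $A\cdot B$ is the sum, over the classical crossings of a strand of $A$ with a strand of $B$,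 of $+1$ if the directions ($A$, $B$) form a positive basis of the plane and $-1$ otherwise. Let $d$ be a classical crossing at which $T_i$ passes over $T_j$, and smooth $d$ respecting orientations. - If $i=j$, let $D_s$ be the component of the smoothed diagram containing the starting point of $T_i$ and $D$ the rest of the diagram; $W^h(d)=D\cdot D_s$. - If $i\ne j$ and $T_i,T_j$ are both long, let $D_+$ and $D_-$ be the components of the smoothed diagram that pass on the left and on the right of the smoothed crossing, and let $D_\varepsilon$ be the one with $\varepsilon=\mathrm{sgn}(d)$ and $D'$ the rest of the diagram; $W^h(d)=(c_i-c_j)+D'\cdot D_\varepsilon$. - If $i\ne j$ and at least one of $T_i,T_j$ is closed, first connect $T_i$ and $T_j$ right after their starting points by an orientation-preserving bridge (a strand arriving there along $T_i$ continues into $T_j$ and vice versa; the bridge meets other strands only in virtual crossings), then smooth $d$ and define $W^h(d)$ as in the previous case. A self-crossing of $T_i$ is an early under- (over-) crossing if $T_i$, followed from its starting point, first traverses it along the understrand (overstrand). **Claim.** The MAIP is expressed by the homological weights as $$p_T(t_1,\dots,t_n)=\sum_i\sum_{\substack{d\in T_i\\ \text{early undercr.}}}\mathrm{sgn}(d)\,t_i^{-W^h(d)+2\delta_i}+\sum_i\sum_{\substack{d\in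 T_i\\ \text{early overcr.}}}\mathrm{sgn}(d)\,t_i^{W^h(d)}+\sum_{i\ne j}\ \sum_{d:\ T_i\text{ over }T_j}\mathrm{sgn}(d)\,t_i^{W^h(d)}-\sum_{i,j}\ \sum_{d:\ T_i\text{ over }T_j}\mathrm{sgn}(d)\,t_i^{\delta_j}.$$ -/

import Mathlib

open scoped BigOperators

namespace VirtualTangle

/-- The decoration of a crossing (a 4-valent vertex) of a virtual tangle diagram. -/
inductive CrossingKind
  | positive
  | negative
  | virtual

/-- The two strands through a crossing of an oriented diagram. Turn the crossing so that both strands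
run upwards: `toRight` runs from bottom left to top right, `toLeft` from bottom right to top left. -/
inductive Strand
  | toRight
  | toLeft

/-- The other strand through the same crossing. -/
def Strand.other : Strand → Strand
  | .toRight => .toLeft
  | .toLeft => .toRight

/-- A diagram of an oriented virtual tangle with ordered components `T_0, …, T_{n-1}`, each of them
long (an arc) or closed (a circle with a chosen starting point), and with set of crossings `X`,
classical and virtual. Traversing component `i` from its starting point, one passes through crossings
`length i` times; `strandAt` records through which crossing, and along which of its two strands, every
such passage goes. Each strand of each crossing is traversed exactly once. -/
structure Diagram (n : ℕ) (X : Type*) where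
  kind : X → CrossingKind
  closed : Fin n → Prop
  length : Fin n → ℕ
  strandAt : (Σ i : Fin n, Fin (length i)) ≃ X × Strand

/-- The ring `ℤ[t_0^{±1}, …, t_{n-1}^{±1}]` of Laurent polynomials. -/
abbrev Laurent (n : ℕ) : Type := AddMonoidAlgebra ℤ (Fin n →₀ ℤ)

/-- The monomial `t_i ^ k`. -/
noncomputable def tpow {n : ℕ} (i : Fin n) (k : ℤ) : Laurent n :=
  AddMonoidAlgebra.single (Finsupp.single i k) 1

namespace Diagram

variable {n : ℕ} {X : Type*} (D : Diagram n X)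

/-- A passage `⟨i, k⟩`: the `k`-th time that component `i` goes through a crossing. -/
abbrev Passage : Type := Σ i : Fin n, Fin (D.length i)

/-- The passage that traverses strand `s` of the crossing `x`. -/
def passage (x : X) (s : Strand) : D.Passage := D.strandAt.symm (x, s)

/-- The crossing `x` is classical, that is, not virtual. -/
def Classical (x : X) : Prop := D.kind x ≠ CrossingKind.virtual

/-- The sign of a classical crossing (with value `0` at virtual crossings, which is never used). -/
def sgn (x : X) : ℤ :=
  match D.kind x with
  | .positive => 1
  | .negative => -1
  | .virtual => 0

/-- The overstrand of a classical crossing: at a positive crossing the strand running from bottom left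
to top right passes over, at a negative one the other strand does. (The value at virtual crossings
is never used.) -/
def overStrand (x : X) : Strand :=
  match D.kind x with
  | .positive => .toRight
  | .negative => .toLeft
  | .virtual => .toLeft

/-- The passage along the overstrand. -/
def overPassage (x : X) : D.Passage := D.passage x (D.overStrand x)

/-- The passage along the understrand. -/
def underPassage (x : X) : D.Passage := D.passage x (D.overStrand x).other

/-! ### The affine labeling and the polynomial -/

/-- The change of the label along a passage: `-1` when running from bottom left to top right through a
classical crossing, `+1` when running from bottom right to top left through one, and `0` at virtual
crossings. -/
def labelChange (p : D.Passage) : ℤ :=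
  match D.kind (D.strandAt p).1, (D.strandAt p).2 with
  | .virtual, _ => 0
  | _, .toRight => -1
  | _, .toLeft => 1

/-- The affine labeling with starting labels `c`. The passages cut component `i` into the arcs
`0, …, length i`, where arc `k` comes just before passage `k` and arc `k + 1` just after it;
arc `0` begins, and arc `length i` ends, at the starting point if the component is closed. -/
def label (c : Fin n → ℤ) (i : Fin n) (k : Fin (D.length i + 1)) : ℤ :=
  Fin.induction (motive := fun _ => ℤ) (c i) (fun m a => a + D.labelChange ⟨i, m⟩) k

/-- The label on the arc entering a passage. -/
def inLabel (c : Fin n → ℤ) (p : D.Passage) : ℤ := D.label c p.1 p.2.castSucc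

/-- The index difference `δ_i`: final label minus initial label of component `i`. -/
def indexDiff (c : Fin n → ℤ) (i : Fin n) : ℤ :=
  D.label c i (Fin.last (D.length i)) - D.label c i 0

/-- The weight `W(d) = a - b - sgn d`, for incoming labels `a` on the overstrand and `b` on the
understrand. -/
def weight (c : Fin n → ℤ) (d : X) : ℤ :=
  D.inLabel c (D.overPassage d) - D.inLabel c (D.underPassage d) - D.sgn d

open scoped Classical in
/-- The classical crossings at which `T_i` passes over `T_j`. -/
noncomputable def overCrossings [Fintype X] (i j : Fin n) : Finset X :=
  Finset.univ.filter fun d =>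
    D.Classical d ∧ (D.overPassage d).1 = i ∧ (D.underPassage d).1 = j

/-- The multi-variable affine index polynomial. -/
noncomputable def maip [Fintype X] (c : Fin n → ℤ) : Laurent n :=
  ∑ i, ∑ j, ∑ d ∈ D.overCrossings i j,
    D.sgn d • (tpow i (D.indexDiff c j) * (tpow i (D.weight c d) - 1))

open scoped Classical in
/-- The self-crossings of `T_i` at which `T_i`, from its starting point, runs along the understrand
before it runs along the overstrand. -/
noncomputable def earlyUnder [Fintype X] (i : Fin n) : Finset X :=
  (D.overCrossings i i).filter fun d =>
    ((D.underPassage d).2 : ℕ) < ((D.overPassage d).2 : ℕ)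

open scoped Classical in
/-- The self-crossings of `T_i` at which `T_i`, from its starting point, runs along the overstrand
before it runs along the understrand. -/
noncomputable def earlyOver [Fintype X] (i : Fin n) : Finset X :=
  (D.overCrossings i i).filter fun d =>
    ((D.overPassage d).2 : ℕ) < ((D.underPassage d).2 : ℕ)

/-! ### Smoothings, bridges and the homological weights -/

/-- The segments of the diagram: `initial i` is a short segment of `T_i` which begins at the starting
point, and is followed by the arcs `arc i 0, …, arc i (length i)`. -/
inductive Segment
  | initial (i : Fin n) : Segment
  | arc (i : Fin n) (k : Fin (D.length i + 1)) : Segment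

/-- The segment that enters a passage. -/
def inSeg (p : D.Passage) : D.Segment := .arc p.1 p.2.castSucc

/-- The segment that leaves a passage. -/
def outSeg (p : D.Passage) : D.Segment := .arc p.1 p.2.succ

/-- `Step d σ e e'`: in the diagram obtained by the oriented smoothing of the crossing `d`, the segment
`e` runs into the segment `e'`. Right after the starting points the strands are reconnected
according to `σ`: for `σ = 1` nothing is changed there, and for `σ = Equiv.swap i j` an orientation
preserving bridge is inserted between `T_i` and `T_j`. The virtual crossings of the bridge with
other strands do not affect how the strands are connected and are not recorded. -/
inductive Step (d : X) (σ : Equiv.Perm (Fin n)) : D.Segment → D.Segment → Prop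
  | through (p : D.Passage) (h : (D.strandAt p).1 ≠ d) : Step d σ (D.inSeg p) (D.outSeg p)
  | smooth (s : Strand) :
      Step d σ (D.inSeg (D.passage d s)) (D.outSeg (D.passage d s.other))
  | start (i : Fin n) : Step d σ (.initial i) (.arc (σ i) 0)
  | close (i : Fin n) (h : D.closed i) :
      Step d σ (.arc i (Fin.last (D.length i))) (.initial i)

/-- The component containing the segment `e` of the diagram smoothed at `d` and reconnected by `σ`. -/
def component (d : X) (σ : Equiv.Perm (Fin n)) (e : D.Segment) : Set D.Segment :=
  {e' | Relation.EqvGen (D.Step d σ) e e'}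

/-- The part on the left of the smoothed crossing `d`: it enters at the bottom left. -/
def leftHalf (d : X) (σ : Equiv.Perm (Fin n)) : Set D.Segment :=
  D.component d σ (D.inSeg (D.passage d .toRight))

/-- The part on the right of the smoothed crossing `d`: it enters at the bottom right. -/
def rightHalf (d : X) (σ : Equiv.Perm (Fin n)) : Set D.Segment :=
  D.component d σ (D.inSeg (D.passage d .toLeft))

/-- The half selected by the sign of `d`: left if `d` is positive, right if `d` is negative. -/
def signHalf (d : X) (σ : Equiv.Perm (Fin n)) : Set D.Segment :=
  match D.kind d with
  | .positive => D.leftHalf d σ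
  | .negative => D.rightHalf d σ
  | .virtual => ∅

open scoped Classical in
/-- The intersection pairing `A · B` of two parts (unions of components) of the diagram smoothed at
`d`. These parts, drawn on the surface of the virtual tangle, meet in the classical crossings other
than `d` of a strand of `A` with a strand of `B`; such a point counts `+1` if the directions of
(`A`, `B`) form a positive basis of the tangent plane, which means that `A` runs from bottom left to
top right and `B` from bottom right to top left, and `-1` otherwise. -/
noncomputable def pairing [Fintype X] (d : X) (A B : Set D.Segment) : ℤ :=
  ∑ x ∈ Finset.univ.filter (fun x => D.Classical x ∧ x ≠ d),
    ((if D.inSeg (D.passage x .toRight) ∈ A ∧ D.inSeg (D.passage x .toLeft) ∈ B then 1 else 0) -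
     (if D.inSeg (D.passage x .toLeft) ∈ A ∧ D.inSeg (D.passage x .toRight) ∈ B then 1 else 0))

open scoped Classical in
/-- The homological weight `W^h(d)` of a classical crossing `d` where `T_i` passes over `T_j`; in every
case the rest of the diagram is paired with one component of the smoothed diagram.
* Self-crossing: the component of the smoothed diagram that contains the starting point of `T_i`.
* Mixed crossing of two long components: the left or right half, according to the sign of `d`, and
  `c_i - c_j` is added.
* Mixed crossing with `T_i` or `T_j` closed: the same, after inserting a bridge between them. -/
noncomputable def homWeight [Fintype X] (c : Fin n → ℤ) (d : X) : ℤ :=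
  let i := (D.overPassage d).1
  let j := (D.underPassage d).1
  if i = j then
    D.pairing d (D.component d 1 (.initial i))ᶜ (D.component d 1 (.initial i))
  else if ¬ D.closed i ∧ ¬ D.closed j then
    (c i - c j) + D.pairing d (D.signHalf d 1)ᶜ (D.signHalf d 1)
  else
    (c i - c j) +
      D.pairing d (D.signHalf d (Equiv.swap i j))ᶜ (D.signHalf d (Equiv.swap i j))

end Diagram

end VirtualTangle

/-!
Smoothing a crossing `d` with passages `p` and `q` joins the part of a component that leads up to
`p` with the part of a component that starts after `q`. In the pairing of the complement of a union
`S` of components with `S`, a crossing of `S` with itself would count `-1 + 1 = 0`, so the pairing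
is the total label change along `S`. On the spliced path it telescopes to
`(in p - c p.1) + (c q.1 + δ q.1 - out q)`, where `in` and `out` are the labels before and after a
passage, while `W(d) = in over - out under` and `-W(d) = in under - out over`. Taking for `p` the
overpassage at a mixed crossing and the earlier passage at a self-crossing of `T_i`, one obtains
`W^h(d) = W(d) + δ_j`, except that `W^h(d) = -W(d) + δ_i` at early undercrossings.
-/

namespace VirtualTangle

theorem sum_sub_of_castSucc_mem_Ico {M : Type*} [AddCommGroup M] {n : ℕ} (f : Fin (n + 1) → M)
    {a b : Fin (n + 1)} (hab : a ≤ b) :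
    ∑ k : Fin n with k.castSucc ∈ Finset.Ico a b, (f k.succ - f k.castSucc) = f b - f a := by
  rcases hab.eq_or_lt with rfl | hlt
  · simp
  obtain ⟨a, rfl⟩ := Fin.exists_castSucc_eq.mpr (Fin.ne_last_of_lt hlt)
  obtain ⟨b, rfl⟩ := Fin.exists_succ_eq.mpr (Fin.ne_zero_of_lt hlt)
  rw [← Fin.sum_Icc_sub (Fin.castSucc_lt_succ_iff.mp hlt) f]
  congr 1
  ext k
  simp

theorem sum_sum_eq_sum_diag_add_sum_ne {ι M : Type*} [Fintype ι] [DecidableEq ι]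
    [AddCommMonoid M] (f : ι → ι → M) :
    ∑ i, ∑ j, f i j = ∑ i, f i i + ∑ i, ∑ j with i ≠ j, f i j := by
  rw [← Finset.sum_add_distrib]
  refine Finset.sum_congr rfl fun i _ => ?_
  rw [← Finset.sum_filter_add_sum_filter_not Finset.univ (i = ·) (f i), Finset.filter_eq]
  simp

theorem tpow_add {n : ℕ} (i : Fin n) (k l : ℤ) : tpow i (k + l) = tpow i k * tpow i l := by
  simp [tpow, AddMonoidAlgebra.single_mul_single, Finsupp.single_add]

instance : Fintype Strand :=
  ⟨.cons .toRight {.toLeft} (by simp), fun s => by cases s <;> simp⟩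

theorem Strand.sum_univ {M : Type*} [AddCommMonoid M] (f : Strand → M) :
    ∑ s, f s = f .toRight + f .toLeft :=
  (Finset.sum_cons (by simp)).trans (congrArg _ (Finset.sum_singleton f _))

theorem Strand.other_other (s : Strand) : s.other.other = s := by
  cases s <;> rfl

theorem Strand.eq_or_eq_other (s t : Strand) : s = t ∨ s = t.other := by
  cases s <;> cases t <;> simp [Strand.other]

namespace Diagram

variable {n : ℕ} {X : Type*} (D : Diagram n X)

section Order

variable {D} {p q : D.Passage}

-- `Passage` carries the disjoint sum order of its fibres: passages of different components are
-- incomparable.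
theorem passage_le_iff : p ≤ q ↔ p.1 = q.1 ∧ (p.2 : ℕ) ≤ q.2 := by
  obtain ⟨i, k⟩ := p
  obtain ⟨j, l⟩ := q
  rw [Sigma.le_def]
  constructor
  · rintro ⟨hij, h⟩
    obtain rfl : i = j := hij
    exact ⟨rfl, h⟩
  · rintro ⟨hij, h⟩
    obtain rfl : i = j := hij
    exact ⟨rfl, h⟩

theorem passage_lt_iff : p < q ↔ p.1 = q.1 ∧ (p.2 : ℕ) < q.2 := by
  rw [lt_iff_le_not_ge, passage_le_iff, passage_le_iff]
  omega

end Order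

/-! ### The labels along a component -/

/-- The label on the arc leaving a passage. -/
def outLabel (c : Fin n → ℤ) (p : D.Passage) : ℤ := D.label c p.1 p.2.succ

theorem label_zero (c : Fin n → ℤ) (i : Fin n) : D.label c i 0 = c i := rfl

theorem label_succ (c : Fin n → ℤ) (i : Fin n) (k : Fin (D.length i)) :
    D.label c i k.succ = D.label c i k.castSucc + D.labelChange ⟨i, k⟩ :=
  Fin.induction_succ ..

theorem outLabel_eq_inLabel_add (c : Fin n → ℤ) (p : D.Passage) :
    D.outLabel c p = D.inLabel c p + D.labelChange p :=
  D.label_succ c p.1 p.2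

theorem sum_labelChange_of_castSucc_mem_Ico (c : Fin n → ℤ) {i : Fin n}
    {a b : Fin (D.length i + 1)} (hab : a ≤ b) :
    ∑ k : Fin (D.length i) with k.castSucc ∈ Finset.Ico a b, D.labelChange ⟨i, k⟩ =
      D.label c i b - D.label c i a := by
  rw [← sum_sub_of_castSucc_mem_Ico (D.label c i) hab]
  simp only [label_succ, add_sub_cancel_left]

theorem sum_Iio_labelChange (c : Fin n → ℤ) (p : D.Passage) :
    ∑ r ∈ Finset.Iio p, D.labelChange r = D.inLabel c p - c p.1 := by
  obtain ⟨i, k⟩ := p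
  rw [Sigma.Iio_mk, Finset.sum_map, inLabel, ← D.label_zero c,
    ← D.sum_labelChange_of_castSucc_mem_Ico c (Fin.zero_le k.castSucc)]
  congr 1
  ext l
  simp

theorem sum_Ioi_labelChange (c : Fin n → ℤ) (q : D.Passage) :
    ∑ r ∈ Finset.Ioi q, D.labelChange r = c q.1 + D.indexDiff c q.1 - D.outLabel c q := by
  obtain ⟨i, k⟩ := q
  rw [Sigma.Ioi_mk, Finset.sum_map, indexDiff, label_zero, add_sub_cancel, outLabel,
    ← D.sum_labelChange_of_castSucc_mem_Ico c (Fin.le_last k.succ)]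
  congr 1
  ext l
  simp

/-- `p` and `q` are the two passages through the crossing `d`, in some order. -/
def MeetAt (d : X) (p q : D.Passage) : Prop :=
  ∃ s, D.passage d s = p ∧ D.passage d s.other = q

theorem strandAt_passage (x : X) (s : Strand) : D.strandAt (D.passage x s) = (x, s) :=
  D.strandAt.apply_symm_apply _

theorem meetAt_overPassage_underPassage (d : X) :
    D.MeetAt d (D.overPassage d) (D.underPassage d) :=
  ⟨D.overStrand d, rfl, rfl⟩

namespace MeetAt

variable {D} {d : X} {p q : D.Passage}

protected theorem symm (h : D.MeetAt d p q) : D.MeetAt d q p := by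
  obtain ⟨s, rfl, rfl⟩ := h
  exact ⟨s.other, rfl, by rw [s.other_other]⟩

protected theorem ne (h : D.MeetAt d p q) : p ≠ q := by
  obtain ⟨s, rfl, rfl⟩ := h
  cases s <;> simp [passage, Strand.other]

theorem crossing_eq_iff (h : D.MeetAt d p q) (r : D.Passage) :
    (D.strandAt r).1 = d ↔ r = p ∨ r = q := by
  obtain ⟨s, rfl, rfl⟩ := h
  simp only [passage, Equiv.eq_symm_apply, Prod.ext_iff, ← and_or_left,
    Strand.eq_or_eq_other, and_true]

end MeetAt

theorem labelChange_overPassage {d : X} (hd : D.Classical d) :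
    D.labelChange (D.overPassage d) = -D.sgn d := by
  unfold Classical at hd
  unfold labelChange overPassage overStrand sgn
  cases h : D.kind d <;> simp_all [strandAt_passage]

theorem labelChange_underPassage {d : X} (hd : D.Classical d) :
    D.labelChange (D.underPassage d) = D.sgn d := by
  unfold Classical at hd
  unfold labelChange underPassage overStrand sgn
  cases h : D.kind d <;> simp_all [strandAt_passage, Strand.other]

theorem inLabel_overPassage_sub_outLabel_underPassage (c : Fin n → ℤ) {d : X}
    (hd : D.Classical d) :
    D.inLabel c (D.overPassage d) - D.outLabel c (D.underPassage d) = D.weight c d := by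
  rw [outLabel_eq_inLabel_add, D.labelChange_underPassage hd, weight, sub_add_eq_sub_sub]

theorem inLabel_underPassage_sub_outLabel_overPassage (c : Fin n → ℤ) {d : X}
    (hd : D.Classical d) :
    D.inLabel c (D.underPassage d) - D.outLabel c (D.overPassage d) = -D.weight c d := by
  rw [outLabel_eq_inLabel_add, D.labelChange_overPassage hd, weight]
  ring

open scoped Classical in
theorem pairing_compl [Fintype X] (d : X) (S : Set D.Segment) :
    D.pairing d Sᶜ S =
      ∑ p : D.Passage with (D.strandAt p).1 ≠ d ∧ D.inSeg p ∈ S, D.labelChange p := by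
  rw [pairing, Finset.sum_filter, Finset.sum_filter, ← Equiv.sum_comp D.strandAt.symm,
    Fintype.sum_prod_type]
  have self_crossings_cancel (P Q : Prop) :
      ((if ¬P ∧ Q then 1 else 0) - (if ¬Q ∧ P then 1 else 0) : ℤ) =
        (if P then -1 else 0) + (if Q then 1 else 0) := by
    by_cases P <;> by_cases Q <;> simp [*]
  refine Finset.sum_congr rfl fun x _ => ?_
  simp only [Strand.sum_univ, ← passage.eq_1, strandAt_passage, Set.mem_compl_iff,
    self_crossings_cancel]
  rcases eq_or_ne x d with rfl | hx
  · simp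
  · cases hk : D.kind x <;> simp [labelChange, strandAt_passage, Classical, hk, hx]

/-! ### The components of the smoothed diagram -/

theorem mem_iff_of_mem_component {d : X} {σ : Equiv.Perm (Fin n)} {S : Set D.Segment}
    (hS : ∀ e e', D.Step d σ e e' → (e ∈ S ↔ e' ∈ S)) {e e' : D.Segment}
    (h : e' ∈ D.component d σ e) : e ∈ S ↔ e' ∈ S :=
  ((eq_equivalence.comap (· ∈ S)).eqvGen_iff.mp
    (Relation.EqvGen.mono (fun a b hab => propext (hS a b hab)) _ _ h)).to_iff

theorem eqvGen_step_arc {d : X} {σ : Equiv.Perm (Fin n)} {i : Fin n}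
    {a b : Fin (D.length i + 1)} (hab : a ≤ b)
    (h : ∀ k : Fin (D.length i), a ≤ k.castSucc → k.castSucc < b → (D.strandAt ⟨i, k⟩).1 ≠ d) :
    Relation.EqvGen (D.Step d σ) (.arc i a) (.arc i b) := by
  induction b using Fin.induction with
  | zero => rw [Fin.le_zero_iff.mp hab]; exact .refl _
  | succ k ih =>
    rcases hab.eq_or_lt with rfl | hlt
    · exact .refl _
    · have hak : a ≤ k.castSucc := Fin.le_castSucc_iff.mpr hlt
      refine .trans _ _ _ (ih hak fun l hal hlk => h l hal (hlk.trans k.castSucc_lt_succ)) ?_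
      exact .rel _ _ (.through ⟨i, k⟩ (h k hak k.castSucc_lt_succ))

/-- The path that runs through the segment `initial m`, then along the component of `p` from its
arc `0` up to the passage `p`, and then along the component of `q` from the passage `q` to its
end. -/
def splicedPath (m : Fin n) (p q : D.Passage) : Set D.Segment :=
  {e | match e with
    | .initial i => i = m
    | .arc i k => (i = p.1 ∧ (k : ℕ) ≤ p.2) ∨ (i = q.1 ∧ (q.2 : ℕ) < k)}

section SplicedPath

variable {D} {d : X} {σ : Equiv.Perm (Fin n)} {m : Fin n} {p q : D.Passage}

theorem initial_mem_splicedPath {i : Fin n} : .initial i ∈ D.splicedPath m p q ↔ i = m :=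
  Iff.rfl

theorem arc_mem_splicedPath {i : Fin n} {k : Fin (D.length i + 1)} :
    .arc i k ∈ D.splicedPath m p q ↔
      (i = p.1 ∧ (k : ℕ) ≤ p.2) ∨ (i = q.1 ∧ (q.2 : ℕ) < k) :=
  Iff.rfl

theorem arc_zero_mem_splicedPath {i : Fin n} : .arc i 0 ∈ D.splicedPath m p q ↔ i = p.1 := by
  simp [arc_mem_splicedPath]

theorem arc_last_mem_splicedPath {i : Fin n} :
    .arc i (Fin.last _) ∈ D.splicedPath m p q ↔ i = q.1 := by
  rw [arc_mem_splicedPath, Fin.val_last]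
  constructor
  · rintro (⟨rfl, hle⟩ | ⟨rfl, -⟩)
    · exact absurd p.2.isLt hle.not_gt
    · rfl
  · rintro rfl
    exact .inr ⟨rfl, q.2.isLt⟩

theorem inSeg_mem_splicedPath {r : D.Passage} :
    D.inSeg r ∈ D.splicedPath m p q ↔ r ≤ p ∨ q < r := by
  rw [inSeg, arc_mem_splicedPath, passage_le_iff, passage_lt_iff, Fin.val_castSucc,
    eq_comm (a := q.1)]

theorem outSeg_mem_splicedPath {r : D.Passage} :
    D.outSeg r ∈ D.splicedPath m p q ↔ r < p ∨ q ≤ r := by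
  rw [outSeg, arc_mem_splicedPath, passage_le_iff, passage_lt_iff, Fin.val_succ,
    eq_comm (a := q.1), Nat.succ_le_iff, Nat.lt_succ_iff]

theorem MeetAt.mem_splicedPath_iff_of_step (h : D.MeetAt d p q) (hstart : σ m = p.1)
    (hclose : ∀ i, D.closed i → (i = q.1 ↔ i = m)) {e e' : D.Segment} (he : D.Step d σ e e') :
    e ∈ D.splicedPath m p q ↔ e' ∈ D.splicedPath m p q := by
  cases he with
  | through r hr =>
    obtain ⟨hrp, hrq⟩ := not_or.mp (mt (h.crossing_eq_iff r).mpr hr)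
    rw [inSeg_mem_splicedPath, outSeg_mem_splicedPath, le_iff_lt_or_eq, or_iff_left hrp,
      le_iff_lt_or_eq, or_iff_left (Ne.symm hrq)]
  | smooth t =>
    obtain ⟨s, rfl, rfl⟩ := h
    rcases t.eq_or_eq_other s with rfl | rfl
    · simp [inSeg_mem_splicedPath, outSeg_mem_splicedPath]
    · simp [inSeg_mem_splicedPath, outSeg_mem_splicedPath, s.other_other]
  | start i =>
    rw [initial_mem_splicedPath, arc_zero_mem_splicedPath, ← hstart, σ.apply_eq_iff_eq]
  | close i hi =>
    rw [initial_mem_splicedPath, arc_last_mem_splicedPath, hclose i hi]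

theorem MeetAt.eqvGen_step_of_mem_splicedPath (h : D.MeetAt d p q) (hqp : ¬ q < p)
    (hstart : σ m = p.1) {e : D.Segment} (he : e ∈ D.splicedPath m p q) :
    Relation.EqvGen (D.Step d σ) (D.inSeg p) e := by
  have crossing_ne_of_lt {r} (hr : r < p) : (D.strandAt r).1 ≠ d := by
    rw [Ne, h.crossing_eq_iff]
    rintro (rfl | rfl)
    exacts [hr.false, hqp hr]
  have crossing_ne_of_gt {r} (hr : q < r) : (D.strandAt r).1 ≠ d := by
    rw [Ne, h.crossing_eq_iff]
    rintro (rfl | rfl)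
    exacts [hqp hr, hr.false]
  have before_p (k : Fin (D.length p.1 + 1)) (hk : k ≤ p.2.castSucc) :
      Relation.EqvGen (D.Step d σ) (D.inSeg p) (.arc p.1 k) :=
    (D.eqvGen_step_arc hk fun _ _ hl => crossing_ne_of_lt (passage_lt_iff.mpr ⟨rfl, hl⟩)).symm
  rcases e with i | ⟨i, k⟩
  · rw [initial_mem_splicedPath.mp he]
    have enter : Relation.EqvGen (D.Step d σ) (.initial m) (.arc p.1 0) :=
      hstart ▸ .rel _ _ (.start m)
    exact (before_p 0 (Fin.zero_le _)).trans _ _ _ enter.symm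
  · rcases he with ⟨rfl, hk⟩ | ⟨rfl, hk⟩
    · exact before_p k hk
    · have turn : Relation.EqvGen (D.Step d σ) (D.inSeg p) (D.outSeg q) := by
        obtain ⟨s, rfl, rfl⟩ := h
        exact .rel _ _ (.smooth s)
      exact turn.trans _ _ _ <| D.eqvGen_step_arc hk fun _ hl _ =>
        crossing_ne_of_gt (passage_lt_iff.mpr ⟨rfl, hl⟩)

theorem MeetAt.component_eq_splicedPath (h : D.MeetAt d p q) (hqp : ¬ q < p)
    (hstart : σ m = p.1) (hclose : ∀ i, D.closed i → (i = q.1 ↔ i = m)) {e : D.Segment}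
    (he : e ∈ D.splicedPath m p q) : D.component d σ e = D.splicedPath m p q := by
  ext e'
  refine ⟨fun he' => ?_, fun he' => ?_⟩
  · exact (D.mem_iff_of_mem_component (fun _ _ => h.mem_splicedPath_iff_of_step hstart hclose)
      he').mp he
  · exact (h.eqvGen_step_of_mem_splicedPath hqp hstart he).symm.trans _ _ _
      (h.eqvGen_step_of_mem_splicedPath hqp hstart he')

theorem MeetAt.pairing_compl_splicedPath [Fintype X] (h : D.MeetAt d p q) (hqp : ¬ q < p)
    (c : Fin n → ℤ) :
    D.pairing d (D.splicedPath m p q)ᶜ (D.splicedPath m p q) =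
      (D.inLabel c p - c p.1) + (c q.1 + D.indexDiff c q.1 - D.outLabel c q) := by
  classical
  have hdisj : Disjoint (Finset.Iio p) (Finset.Ioi q) := Finset.disjoint_left.mpr fun r hr hr' =>
    hqp ((Finset.mem_Ioi.mp hr').trans (Finset.mem_Iio.mp hr))
  rw [pairing_compl, ← sum_Iio_labelChange, ← sum_Ioi_labelChange, ← Finset.sum_union hdisj]
  congr 1
  ext r
  simp only [Finset.mem_filter_univ, Finset.mem_union, Finset.mem_Iio, Finset.mem_Ioi, Ne,
    h.crossing_eq_iff, inSeg_mem_splicedPath]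
  constructor
  · rintro ⟨hr, hrp | hqr⟩
    · exact .inl (hrp.lt_of_ne fun hrp => hr (.inl hrp))
    · exact .inr hqr
  · rintro (hrp | hqr)
    · exact ⟨by rintro (rfl | rfl); exacts [hrp.false, hqp hrp], .inl hrp.le⟩
    · exact ⟨by rintro (rfl | rfl); exacts [hqp hqr, hqr.false], .inr hqr⟩

end SplicedPath

/-! ### The homological weights -/

theorem signHalf_eq_component {d : X} (hd : D.Classical d) (σ : Equiv.Perm (Fin n)) :
    D.signHalf d σ = D.component d σ (D.inSeg (D.overPassage d)) := by
  unfold Classical at hd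
  unfold signHalf overPassage overStrand leftHalf rightHalf
  cases h : D.kind d <;> simp_all

section HomWeight

variable {D} [Fintype X] (c : Fin n → ℤ) {d : X} {p q : D.Passage}

theorem MeetAt.pairing_compl_component_initial (h : D.MeetAt d p q) (hpq : p < q) :
    D.pairing d (D.component d 1 (.initial p.1))ᶜ (D.component d 1 (.initial p.1)) =
      D.inLabel c p - D.outLabel c q + D.indexDiff c p.1 := by
  have hcomp : p.1 = q.1 := (passage_lt_iff.mp hpq).1
  rw [h.component_eq_splicedPath hpq.not_gt (m := p.1) rfl (fun _ _ => by rw [hcomp])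
    (initial_mem_splicedPath.mpr rfl), h.pairing_compl_splicedPath hpq.not_gt c, hcomp]
  ring

theorem MeetAt.pairing_compl_component_inSeg (h : D.MeetAt d p q) (hpq : p.1 ≠ q.1)
    {σ : Equiv.Perm (Fin n)} {m : Fin n} (hstart : σ m = p.1)
    (hclose : ∀ i, D.closed i → (i = q.1 ↔ i = m)) :
    (c p.1 - c q.1) + D.pairing d (D.component d σ (D.inSeg p))ᶜ (D.component d σ (D.inSeg p)) =
      D.inLabel c p - D.outLabel c q + D.indexDiff c q.1 := by
  have hqp : ¬ q < p := fun hlt => hpq (passage_lt_iff.mp hlt).1.symm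
  rw [h.component_eq_splicedPath hqp hstart hclose (inSeg_mem_splicedPath.mpr (.inl le_rfl)),
    h.pairing_compl_splicedPath hqp c]
  ring

theorem mem_overCrossings {i j : Fin n} :
    d ∈ D.overCrossings i j ↔
      D.Classical d ∧ (D.overPassage d).1 = i ∧ (D.underPassage d).1 = j := by
  simp [overCrossings]

theorem homWeight_of_mem_earlyOver {i : Fin n} (hd : d ∈ D.earlyOver i) :
    D.homWeight c d = D.weight c d + D.indexDiff c i := by
  obtain ⟨hd, hlt⟩ := Finset.mem_filter.mp hd
  obtain ⟨hcl, rfl, hu⟩ := mem_overCrossings.mp hd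
  rw [homWeight, if_pos hu.symm,
    (D.meetAt_overPassage_underPassage d).pairing_compl_component_initial c
      (passage_lt_iff.mpr ⟨hu.symm, hlt⟩), D.inLabel_overPassage_sub_outLabel_underPassage c hcl]

theorem homWeight_of_mem_earlyUnder {i : Fin n} (hd : d ∈ D.earlyUnder i) :
    D.homWeight c d = -D.weight c d + D.indexDiff c i := by
  obtain ⟨hd, hlt⟩ := Finset.mem_filter.mp hd
  obtain ⟨hcl, ho, rfl⟩ := mem_overCrossings.mp hd
  rw [homWeight, if_pos ho, ho,
    (D.meetAt_overPassage_underPassage d).symm.pairing_compl_component_initial c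
      (passage_lt_iff.mpr ⟨ho.symm, hlt⟩), D.inLabel_underPassage_sub_outLabel_overPassage c hcl]

theorem homWeight_of_mem_overCrossings {i j : Fin n} (hij : i ≠ j)
    (hd : d ∈ D.overCrossings i j) :
    D.homWeight c d = D.weight c d + D.indexDiff c j := by
  obtain ⟨hcl, rfl, rfl⟩ := mem_overCrossings.mp hd
  have h := D.meetAt_overPassage_underPassage d
  rw [← D.inLabel_overPassage_sub_outLabel_underPassage c hcl, homWeight, if_neg hij]
  simp only [D.signHalf_eq_component hcl]
  split_ifs with hlong
  · refine h.pairing_compl_component_inSeg c hij (m := (D.overPassage d).1) rfl fun i hi => ?_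
    exact iff_of_false (fun hu => hlong.2 (hu ▸ hi)) (fun ho => hlong.1 (ho ▸ hi))
  · -- The bridge leads from the start of `T_j` into `T_i`.
    exact h.pairing_compl_component_inSeg c hij (m := (D.underPassage d).1)
      (Equiv.swap_apply_right _ _) fun _ _ => Iff.rfl

end HomWeight

section Polynomial

variable [Fintype X]

theorem sum_overCrossings_self {M : Type*} [AddCommMonoid M] (i : Fin n) (f : X → M) :
    ∑ d ∈ D.overCrossings i i, f d = ∑ d ∈ D.earlyUnder i, f d + ∑ d ∈ D.earlyOver i, f d := by
  classical
  rw [earlyUnder, earlyOver, ← Finset.sum_filter_add_sum_filter_not (D.overCrossings i i)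
    (fun d => ((D.underPassage d).2 : ℕ) < (D.overPassage d).2)]
  congr 2
  refine Finset.filter_congr fun d hd => ?_
  obtain ⟨-, ho, hu⟩ := mem_overCrossings.mp hd
  have hne : ¬ D.overPassage d = D.underPassage d := (D.meetAt_overPassage_underPassage d).ne
  rw [eq_iff_le_not_lt, passage_le_iff, passage_lt_iff] at hne
  simp only [ho, hu, true_and] at hne
  omega

theorem maip_eq_sub (c : Fin n → ℤ) :
    D.maip c =
      (∑ i, ∑ j, ∑ d ∈ D.overCrossings i j, D.sgn d • tpow i (D.weight c d + D.indexDiff c j)) -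
        ∑ i, ∑ j, ∑ d ∈ D.overCrossings i j, D.sgn d • tpow i (D.indexDiff c j) := by
  simp only [maip, ← Finset.sum_sub_distrib, ← smul_sub, add_comm, tpow_add, mul_sub, mul_one]

end Polynomial

end Diagram

end VirtualTangle

theorem mainTheorem6 {n : ℕ} {X : Type*} [Fintype X] (D : VirtualTangle.Diagram n X)
    (c : Fin n → ℤ) :
    D.maip c =
      (∑ i, ∑ d ∈ D.earlyUnder i,
          D.sgn d • VirtualTangle.tpow i (-D.homWeight c d + 2 * D.indexDiff c i))
      + (∑ i, ∑ d ∈ D.earlyOver i, D.sgn d • VirtualTangle.tpow i (D.homWeight c d))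
      + (∑ i, ∑ j ∈ Finset.univ.filter (fun j => i ≠ j), ∑ d ∈ D.overCrossings i j,
          D.sgn d • VirtualTangle.tpow i (D.homWeight c d))
      - (∑ i, ∑ j, ∑ d ∈ D.overCrossings i j,
          D.sgn d • VirtualTangle.tpow i (D.indexDiff c j)) := by
  rw [D.maip_eq_sub, VirtualTangle.sum_sum_eq_sum_diag_add_sum_ne]
  simp only [D.sum_overCrossings_self, Finset.sum_add_distrib]
  congr 2
  · congr 1
    · refine Finset.sum_congr rfl fun i _ => Finset.sum_congr rfl fun d hd => ?_
      rw [VirtualTangle.Diagram.homWeight_of_mem_earlyUnder c hd]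
      congr 2
      ring
    · refine Finset.sum_congr rfl fun i _ => Finset.sum_congr rfl fun d hd => ?_
      rw [VirtualTangle.Diagram.homWeight_of_mem_earlyOver c hd]
  · refine Finset.sum_congr rfl fun i _ => Finset.sum_congr rfl fun j hj =>
      Finset.sum_congr rfl fun d hd => ?_
    rw [VirtualTangle.Diagram.homWeight_of_mem_overCrossings c (Finset.mem_filter.mp hj).2 hd]
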